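/- Let $q$ be a prime power, let $k\ge 0$ and $\ell\ge 1$, and let $S_{1},S_{2}$ be subspaces of $\mathbb F_q^k$ of dimensions $u_1,u_2$ with $\dim(S_1\cap S_2)=0$; exclude the single case $q=k=2$, $u_1=u_2=1$. Let $G$ be a matrix whose columns are the elements of $\mathbb F_q^k\setminus(S_1\cup S_2)$, each occurring once, let $n$ be the number of its columns, and let $C_\ell$ be the lifted code over $\mathbb F_{q^\ell}$, that is, the $\mathbb F_{q^\ell}$-linear span of the rows of $G$. For $1\le i\le n$ and $1\le j\le k$ let $A_i^{(j)}$ be the number of $(k-j)$-dimensional subspaces of $\mathbb F_q^k$ that contain exactly $n-i$ of the $n$ columns of $G$. Write $\begin{bmatrix} a\\ b\end{bmatrix}=\prod_{s=0}^{b-1}\frac{q^a-q^s}{q^b-q^s}$ for integers $a,b\ge 0$, and $\begin{bmatrix} a\\ b\end{bmatrix}=0$ for $b<0$. For integers $d,t_1,t_2\ge 0$ put $$N(k,d,u_1,u_2,t_1,t_2)=\sum_{t=0}^{\min\{u_1-t_1,\,u_2-t_2\}}q^{(u_1+u_2-t-t_1-t_2)(d-t-t_1-t_2)}\,N_t\begin{bmatrix}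 k-u_1-u_2\\ d-t-t_1-t_2\end{bmatrix},$$ $$N_t=\prod_{s=0}^{t-1}(q^t-q^s)\begin{bmatrix} u_1-t_1\\ t\end{bmatrix}\begin{bmatrix} u_2-t_2\\ t\end{bmatrix}\begin{bmatrix} u_1\\ t_1\end{bmatrix}\begin{bmatrix} u_2\\ t_2\end{bmatrix},$$ where the sum is $0$ if $t_1>u_1$ or $t_2>u_2$. Then: (1) $C_\ell$ has length $n=q^k-q^{u_1}-q^{u_2}+1$. (2) The weight enumerator polynomial of $C_\ell$ (the coefficient of $z^i$ being the number of codewords of Hamming weight $i$) is $$A_\ell(z)=1+\sum_{i=1}^n\sum_{j=1}^kA_i^{(j)}(q^\ell-1)(q^\ell-q)\cdots(q^\ell-q^{j-1})z^i .$$ (3) Let $1\le i\le n$ and $1\le j\le k$. If $t_1,t_2$ are integers with $\max\{0,u_r-j\}\le t_r\le u_r$ for $r=1,2$ and $n-i=q^{k-j}-q^{t_1}-q^{t_2}+1$, then $$A_i^{(j)}=\begin{cases}N(k,k-j,u_1,u_2,t_1,t_2)+N(k,k-j,u_1,u_2,t_2,t_1), & t_1\ne t_2,\\ N(k,k-j,u_1,u_2,t_1,t_2),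 & t_1=t_2.\end{cases}$$ If no such $t_1,t_2$ exist, then $A_i^{(j)}=0$. (4) For all integers $d,t_1,t_2\ge 0$, $N(k,d,u_1,u_2,t_1,t_2)$ is the number of $d$-dimensional subspaces $V$ of $\mathbb F_q^k$ with $\dim(V\cap S_1)=t_1$ and $\dim(V\cap S_2)=t_2$. -/

import Mathlib

open Polynomial

noncomputable section

/-- The Gaussian (`q`-binomial) coefficient
`[n, m]_q = ∏_{s < m} (q ^ n - q ^ s) / (q ^ m - q ^ s)`; it vanishes for `m > n`. -/
def gaussBinom (q n m : ℕ) : ℚ :=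
  (∏ s ∈ Finset.range m, ((q : ℚ) ^ n - (q : ℚ) ^ s)) /
    ∏ s ∈ Finset.range m, ((q : ℚ) ^ m - (q : ℚ) ^ s)

/-- `N_t(k, u₁, u₂, t₁, t₂)`. For `t = 0` the product and the first two Gaussian coefficients
are equal to `1`, so that the value is `[u₁, t₁]_q [u₂, t₂]_q`. -/
def subspaceNt (q t u₁ u₂ t₁ t₂ : ℕ) : ℚ :=
  (∏ s ∈ Finset.range t, ((q : ℚ) ^ t - (q : ℚ) ^ s)) *
    gaussBinom q (u₁ - t₁) t * gaussBinom q (u₂ - t₂) t *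
    gaussBinom q u₁ t₁ * gaussBinom q u₂ t₂

/-- The explicit expression `N(k, d, u₁, u₂, t₁, t₂)`. A Gaussian coefficient with negative
lower index `d - t - t₁ - t₂` is zero. If `t₁ > u₁` or `t₂ > u₂` the value is zero, because
the corresponding factor `[u_r, t_r]_q` is. -/
def subspaceN (q k d u₁ u₂ t₁ t₂ : ℕ) : ℚ :=
  ∑ t ∈ Finset.range (min (u₁ - t₁) (u₂ - t₂) + 1),
    if t + t₁ + t₂ ≤ d then
      (q : ℚ) ^ ((u₁ + u₂ - t - t₁ - t₂) * (d - t - t₁ - t₂)) *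
        subspaceNt q t u₁ u₂ t₁ t₂ * gaussBinom q (k - u₁ - u₂) (d - t - t₁ - t₂)
    else 0

/-- The linear code (row space) generated by the rows of a matrix. -/
def rowCode {K : Type*} [Field K] {k n : ℕ} (G : Matrix (Fin k) (Fin n) K) :
    Submodule K (Fin n → K) :=
  Submodule.span K (Set.range fun a => G a)

/-- The lifted code: the code over the extension field `L` with the same generator matrix `G`. -/
def liftedCode {F : Type*} [Field F] (L : Type*) [Field L] [Algebra F L] {k n : ℕ}
    (G : Matrix (Fin k) (Fin n) F) : Submodule L (Fin n → L) :=
  rowCode (G.map (algebraMap F L))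

open Classical in
/-- The weight enumerator polynomial `∑ᵢ Aᵢ zⁱ`, with `Aᵢ` the number of codewords of Hamming
weight `i`. -/
def weightEnumerator {K : Type*} [Field K] {n : ℕ} (C : Submodule K (Fin n → K)) : ℤ[X] :=
  ∑ i ∈ Finset.range (n + 1), Polynomial.C (({c ∈ C | hammingNorm c = i}.ncard : ℕ) : ℤ) * X ^ i

/-- `G` is a matrix whose columns are the elements of `U`, each occurring exactly once, in some
order. -/
def HasColumns {F : Type*} {k n : ℕ} (G : Matrix (Fin k) (Fin n) F)
    (U : Set (Fin k → F)) : Prop :=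
  Set.BijOn (fun m a => G a m) Set.univ U

/-- `A_i^{(j)}`: the number of `(k - j)`-dimensional subspaces of `F ^ k` that contain exactly
`n - i` of the `n` columns of `G`. -/
def subspaceCount {F : Type*} [Field F] {k n : ℕ} (G : Matrix (Fin k) (Fin n) F)
    (i j : ℕ) : ℕ :=
  {V : Submodule F (Fin k → F) | Module.finrank F V + j = k ∧
    {m : Fin n | (fun a => G a m) ∈ V}.ncard + i = n}.ncard

/-- The pairs `(t₁, t₂)` with `max {0, u_r - j} ≤ t_r ≤ u_r` for `r = 1, 2` and
`n - i = q ^ (k - j) - q ^ t₁ - q ^ t₂ + 1`, for `i ≤ n` and `j ≤ k`. -/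
def IsDimPair (q k n u₁ u₂ i j t₁ t₂ : ℕ) : Prop :=
  (u₁ ≤ t₁ + j ∧ t₁ ≤ u₁) ∧ (u₂ ≤ t₂ + j ∧ t₂ ≤ u₂) ∧
    (n : ℤ) - i = (q : ℤ) ^ (k - j) - (q : ℤ) ^ t₁ - (q : ℤ) ^ t₂ + 1

end

/-!
Over `F` a codeword of the lifted code is the vector of values, at the columns of `G`, of an
`F`-linear map `φ : F ^ k → L`, and `φ` is unique as soon as the columns span `F ^ k`. The zeros of
this codeword are the columns in `ker φ`, and exactly `∏_{s < j} (|L| - q ^ s)` maps have a given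
kernel of codimension `j`; sorting the codewords by kernel gives the weight enumerator.

The columns fail to span only in the exceptional case. Suppose a proper subspace `V` contains the
complement of `S₁ ∪ S₂`, and let `x` lie in this complement. Adding `x` moves a vector of `S₁ \ V`
out of `S₁` but not into `V`, hence into `S₂`; as `S₁ ∩ S₂ = 0`, both `S₁ \ V` and `S₂ \ V` are
singletons. This forces `q = 2` and `dim S₁ = dim S₂ = 1`, and the space is `S₁ ⊕ S₂` because the
complement of `V` spans it.

To count the subspaces `V` with prescribed `dim (V ∩ S₁)` and `dim (V ∩ S₂)`, fix first
`T_r = V ∩ S_r`, then `W = V ∩ (S₁ ⊕ S₂)`, then `V`. Extensions of a subspace `T` are counted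
through frames, the tuples that are independent modulo `T`. A frame of `W` over `T₁ ⊕ T₂` is `a + b`
for a unique frame `a` of `S₁` modulo `T₁` and a unique frame `b` of `S₂` modulo `T₂` of the same
length `t`, which produces `N_t`; a frame of `V` over `W` is any tuple independent modulo `S₁ ⊕ S₂`.

By inclusion-exclusion `V` contains `q ^ dim V - q ^ dim (V ∩ S₁) - q ^ dim (V ∩ S₂) + 1` columns,
and a sum of two powers of `q` determines the unordered pair of exponents.
-/

open Module (finrank)

section Fibers

variable {α β : Type*} {f : α → β} {s : Set α}

theorem ncard_eq_sum_ncard_fiber (hs : s.Finite) {t : Finset β} (hf : Set.MapsTo f s t) :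
    s.ncard = ∑ b ∈ t, {a ∈ s | f a = b}.ncard := by
  classical
  rw [Set.ncard_eq_toFinset_card s hs,
    Finset.card_eq_sum_card_fiberwise (t := t) (by simpa using hf)]
  refine Finset.sum_congr rfl fun b _ => ?_
  rw [← Set.ncard_coe_finset]
  simp

theorem ncard_eq_ncard_mul_of_fiber {R : Type*} [Semiring R] {t : Set β} (hs : s.Finite)
    (ht : t.Finite) (hf : Set.MapsTo f s t) {N : R}
    (hN : ∀ b ∈ t, ({a ∈ s | f a = b}.ncard : R) = N) : (s.ncard : R) = t.ncard * N := by
  rw [ncard_eq_sum_ncard_fiber hs (t := ht.toFinset) (by simpa using hf), Nat.cast_sum,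
    Finset.sum_congr rfl fun b hb => hN b (ht.mem_toFinset.1 hb), Finset.sum_const, nsmul_eq_mul,
    Set.ncard_eq_toFinset_card t ht]

end Fibers

section DisjointSubspaces

theorem sup_eq_sup_iff_of_disjoint {α : Type*} [Lattice α] [IsModularLattice α] [OrderBot α]
    {s t x y z : α} (hst : Disjoint s t) (hx : x ≤ s) (hy : y ≤ s) (hz : z ≤ t) :
    x ⊔ z = y ⊔ z ↔ x = y := by
  have hinf {w : α} (hw : w ≤ s) : (w ⊔ z) ⊓ s = w := by
    rw [sup_inf_assoc_of_le z hw, (hst.mono_right hz).symm.eq_bot, sup_bot_eq]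
  exact ⟨fun h => by rw [← hinf hx, h, hinf hy], fun h => by rw [h]⟩

theorem eq_and_eq_of_add_eq_add_of_disjoint {R M : Type*} [Ring R] [AddCommGroup M] [Module R M]
    {N₁ N₂ : Submodule R M} (hN : Disjoint N₁ N₂) {a b c d : M} (ha : a ∈ N₁) (hb : b ∈ N₂)
    (hc : c ∈ N₁) (hd : d ∈ N₂) (h : a + b = c + d) : a = c ∧ b = d := by
  have hzero : a - c + (b - d) = 0 := by rw [sub_add_sub_comm, h, sub_self]
  simpa only [sub_eq_zero] using Submodule.disjoint_iff_add_eq_zero.1 hN (N₁.sub_mem ha hc)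
    (N₂.sub_mem hb hd) hzero

variable {F E : Type*} [Field F] [AddCommGroup E] [Module F E] [Module.Finite F E]

theorem finrank_sup_eq_add_of_disjoint {S₁ S₂ : Submodule F E} (hS : Disjoint S₁ S₂) :
    finrank F ↥(S₁ ⊔ S₂) = finrank F S₁ + finrank F S₂ := by
  rw [← Submodule.finrank_sup_add_finrank_inf_eq, hS.eq_bot, finrank_bot, add_zero]

theorem finrank_le_finrank_add_finrank_inf {A B W : Submodule F E} (hW : W ≤ A ⊔ B) :
    finrank F W ≤ finrank F A + finrank F ↥(W ⊓ B) := by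
  have hWB := Submodule.finrank_sup_add_finrank_inf_eq W B
  have hAB := Submodule.finrank_add_le_finrank_add_finrank A B
  have hle : finrank F ↥(W ⊔ B) ≤ finrank F ↥(A ⊔ B) :=
    Submodule.finrank_mono (sup_le hW le_sup_right)
  omega

theorem finrank_inf_add_finrank_inf_le {S₁ S₂ : Submodule F E} (hS : Disjoint S₁ S₂)
    (V : Submodule F E) :
    finrank F ↥(V ⊓ S₁) + finrank F ↥(V ⊓ S₂) ≤ finrank F ↥(V ⊓ (S₁ ⊔ S₂)) := by
  rw [← finrank_sup_eq_add_of_disjoint (hS.mono inf_le_right inf_le_right)]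
  exact Submodule.finrank_mono le_inf_sup

theorem finrank_inf_sup_le (V S₁ S₂ : Submodule F E) :
    finrank F ↥(V ⊓ (S₁ ⊔ S₂)) ≤ finrank F S₁ + finrank F ↥(V ⊓ S₂) := by
  have h := finrank_le_finrank_add_finrank_inf (inf_le_right : V ⊓ (S₁ ⊔ S₂) ≤ S₁ ⊔ S₂)
  rwa [inf_assoc, inf_eq_right.2 (le_sup_right : S₂ ≤ S₁ ⊔ S₂)] at h

end DisjointSubspaces

section Independence

variable {F E ι : Type*} [Field F] [AddCommGroup E] [Module F E]

theorem linearIndependent_mkQ_comp_iff {B : Submodule F E} {v : ι → E} :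
    LinearIndependent F (B.mkQ ∘ v) ↔
      LinearIndependent F v ∧ Disjoint (Submodule.span F (Set.range v)) B := by
  refine ⟨fun h => ⟨h.of_comp B.mkQ, ?_⟩, fun ⟨h, hB⟩ => ?_⟩
  · simpa only [Submodule.ker_mkQ] using Submodule.range_ker_disjoint h
  · exact (LinearMap.linearIndependent_iff_of_disjoint B.mkQ (by rwa [Submodule.ker_mkQ])).2 h

theorem linearIndependent_mkQ_comp_mono {A B : Submodule F E} (hAB : A ≤ B) {v : ι → E}
    (hv : LinearIndependent F (B.mkQ ∘ v)) : LinearIndependent F (A.mkQ ∘ v) := by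
  rw [linearIndependent_mkQ_comp_iff] at hv ⊢
  exact ⟨hv.1, hv.2.mono_right hAB⟩

theorem linearIndependent_inf_mkQ_comp_iff {A B : Submodule F E} {v : ι → E}
    (hv : ∀ i, v i ∈ A) :
    LinearIndependent F ((A ⊓ B).mkQ ∘ v) ↔ LinearIndependent F (B.mkQ ∘ v) := by
  have hspan : Submodule.span F (Set.range v) ≤ A :=
    Submodule.span_le.2 (Set.range_subset_iff.2 hv)
  simp only [linearIndependent_mkQ_comp_iff, disjoint_iff, ← inf_assoc, inf_eq_left.2 hspan]

theorem linearIndependent_mkQ_comp_add_iff {B : Submodule F E} {v w : ι → E}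
    (hv : ∀ i, v i ∈ B) :
    LinearIndependent F (B.mkQ ∘ (v + w)) ↔ LinearIndependent F (B.mkQ ∘ w) := by
  have hvw : B.mkQ ∘ (v + w) = B.mkQ ∘ w := funext fun i => by
    simp [(Submodule.Quotient.mk_eq_zero B).2 (hv i)]
  rw [hvw]

theorem linearIndependent_mkQ_comp_iff_sup_span_inf_eq {S W : Submodule F E} (hWS : W ≤ S)
    {v : ι → E} (hv : LinearIndependent F (W.mkQ ∘ v)) :
    LinearIndependent F (S.mkQ ∘ v) ↔ (W ⊔ Submodule.span F (Set.range v)) ⊓ S = W := by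
  rw [linearIndependent_mkQ_comp_iff] at hv ⊢
  rw [sup_inf_assoc_of_le _ hWS, sup_eq_left, and_iff_right hv.1, disjoint_iff_inf_le]
  exact ⟨fun h => h.trans bot_le,
    fun h => (le_inf inf_le_left h).trans (disjoint_iff_inf_le.1 hv.2)⟩

theorem linearIndependent_sup_mkQ_comp_add_iff {S₁ S₂ T₁ : Submodule F E} (hS : Disjoint S₁ S₂)
    (h₁ : T₁ ≤ S₁) {a b : ι → E} (ha : ∀ i, a i ∈ S₁) (hb : ∀ i, b i ∈ S₂) :
    LinearIndependent F ((T₁ ⊔ S₂).mkQ ∘ (a + b)) ↔ LinearIndependent F (T₁.mkQ ∘ a) := by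
  have hT : S₁ ⊓ (T₁ ⊔ S₂) = T₁ := by
    rw [inf_comm, sup_inf_assoc_of_le _ h₁, hS.symm.eq_bot, sup_bot_eq]
  rw [add_comm a, linearIndependent_mkQ_comp_add_iff fun i => Submodule.mem_sup_right (hb i),
    ← linearIndependent_inf_mkQ_comp_iff ha, hT]

theorem sup_span_add_inf_eq_iff {S₁ S₂ T₁ T₂ : Submodule F E} (hS : Disjoint S₁ S₂)
    (h₁ : T₁ ≤ S₁) (h₂ : T₂ ≤ S₂) {a b : ι → E} (ha : ∀ i, a i ∈ S₁) (hb : ∀ i, b i ∈ S₂)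
    (hab : LinearIndependent F ((T₁ ⊔ T₂).mkQ ∘ (a + b))) :
    (T₁ ⊔ T₂ ⊔ Submodule.span F (Set.range (a + b))) ⊓ S₂ = T₂ ↔
      LinearIndependent F (T₁.mkQ ∘ a) := by
  have hT₁ : T₁ ≤ T₁ ⊔ T₂ ⊔ Submodule.span F (Set.range (a + b)) :=
    le_sup_left.trans le_sup_left
  rw [← linearIndependent_sup_mkQ_comp_add_iff hS h₁ ha hb,
    linearIndependent_mkQ_comp_iff_sup_span_inf_eq (sup_le_sup_left h₂ T₁) hab, sup_comm T₁ S₂,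
    ← inf_sup_assoc_of_le S₂ hT₁, sup_comm T₁ T₂,
    sup_eq_sup_iff_of_disjoint hS.symm inf_le_right h₂ h₁]

theorem finrank_sup_span_eq [Module.Finite F E] {B : Submodule F E} {m : ℕ} {v : Fin m → E}
    (hv : LinearIndependent F (B.mkQ ∘ v)) :
    finrank F ↥(B ⊔ Submodule.span F (Set.range v)) = finrank F B + m := by
  obtain ⟨hv, hB⟩ := linearIndependent_mkQ_comp_iff.1 hv
  have h := Submodule.finrank_sup_add_finrank_inf_eq B (Submodule.span F (Set.range v))
  rwa [hB.symm.eq_bot, finrank_bot, add_zero, finrank_span_eq_card hv, Fintype.card_fin] at h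

/-- The `m`-tuples of vectors of `A` that are linearly independent modulo `B`. Counting them in
two ways is the source of all the Gaussian binomial coefficients below. -/
def framesMod (A B : Submodule F E) (m : ℕ) : Set (Fin m → E) :=
  {v | (∀ i, v i ∈ A) ∧ LinearIndependent F (B.mkQ ∘ v)}

theorem mem_framesMod_iff_sup_span_eq [Module.Finite F E] {T V : Submodule F E} {m : ℕ}
    {v : Fin m → E} (hTV : T ≤ V) (hV : finrank F V = finrank F T + m) :
    v ∈ framesMod V T m ↔
      LinearIndependent F (T.mkQ ∘ v) ∧ T ⊔ Submodule.span F (Set.range v) = V := by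
  refine ⟨fun ⟨hvV, hv⟩ => ⟨hv, ?_⟩, fun ⟨hv, h⟩ => ⟨fun i => h ▸ ?_, hv⟩⟩
  · exact Submodule.eq_of_le_of_finrank_eq
      (sup_le hTV (Submodule.span_le.2 (Set.range_subset_iff.2 hvV)))
      ((finrank_sup_span_eq hv).trans hV.symm)
  · exact Submodule.mem_sup_right (Submodule.subset_span ⟨i, rfl⟩)

theorem setOf_linearIndependent_sup_span_mem_eq_image_add [Module.Finite F E]
    {S₁ S₂ T₁ T₂ : Submodule F E} (hS : Disjoint S₁ S₂) (h₁ : T₁ ≤ S₁) (h₂ : T₂ ≤ S₂) (t : ℕ) :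
    {v : Fin t → E | LinearIndependent F ((T₁ ⊔ T₂).mkQ ∘ v) ∧
      T₁ ⊔ T₂ ⊔ Submodule.span F (Set.range v) ∈
        {W : Submodule F E | W ≤ S₁ ⊔ S₂ ∧ W ⊓ S₁ = T₁ ∧ W ⊓ S₂ = T₂ ∧
          finrank F W = finrank F T₁ + finrank F T₂ + t}} =
      (fun p => p.1 + p.2) '' framesMod S₁ T₁ t ×ˢ framesMod S₂ T₂ t := by
  ext v
  constructor
  · rintro ⟨hv, hle, hW₁, hW₂, -⟩
    choose a ha b hb hab using fun i => Submodule.mem_sup.1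
      (hle (Submodule.mem_sup_right (Submodule.subset_span (Set.mem_range_self i))))
    obtain rfl : a + b = v := funext hab
    refine ⟨(a, b), ⟨⟨ha, (sup_span_add_inf_eq_iff hS h₁ h₂ ha hb hv).1 hW₂⟩, hb, ?_⟩, rfl⟩
    rw [sup_comm T₁, add_comm a] at hv hW₁
    exact (sup_span_add_inf_eq_iff hS.symm h₂ h₁ hb ha hv).1 hW₁
  · rintro ⟨⟨a, b⟩, ⟨⟨ha, haT⟩, hb, hbT⟩, rfl⟩
    have hv : LinearIndependent F ((T₁ ⊔ T₂).mkQ ∘ (a + b)) :=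
      linearIndependent_mkQ_comp_mono (sup_le_sup_left h₂ T₁)
        ((linearIndependent_sup_mkQ_comp_add_iff hS h₁ ha hb).2 haT)
    refine ⟨hv, ?_, ?_, (sup_span_add_inf_eq_iff hS h₁ h₂ ha hb hv).2 haT, ?_⟩
    · exact sup_le (sup_le_sup h₁ h₂) (Submodule.span_le.2 (Set.range_subset_iff.2 fun i =>
        Submodule.add_mem_sup (ha i) (hb i)))
    · dsimp only
      rw [sup_comm T₁, add_comm a] at hv ⊢
      exact (sup_span_add_inf_eq_iff hS.symm h₂ h₁ hb ha hv).2 hbT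
    · rw [finrank_sup_span_eq hv, finrank_sup_eq_add_of_disjoint (hS.mono h₁ h₂)]

end Independence

section Frames

variable {F E E' : Type*} [Field F] [Fintype F] [AddCommGroup E] [Module F E] [Finite E]
  [AddCommGroup E'] [Module F E'] {R : Type*} [CommRing R]

theorem ncard_submodule (V : Submodule F E) :
    (V : Set E).ncard = Fintype.card F ^ finrank F V := by
  rw [← Nat.card_eq_fintype_card, ← Module.natCard_eq_pow_finrank (K := F) (V := V)]
  rfl

variable (F E) in
theorem ncard_linearIndependent (m : ℕ) :
    ({v : Fin m → E | LinearIndependent F v}.ncard : R) =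
      ∏ s ∈ Finset.range m, ((Fintype.card F : R) ^ finrank F E - (Fintype.card F : R) ^ s) := by
  rcases le_or_gt m (finrank F E) with hm | hm
  · rw [← Nat.card_coe_set_eq, Set.coe_ofPred, card_linearIndependent hm, Nat.cast_prod,
      Finset.prod_range]
    refine Finset.prod_congr rfl fun s _ => ?_
    rw [Nat.cast_sub (Nat.pow_le_pow_right Fintype.card_pos (s.2.le.trans hm)), Nat.cast_pow,
      Nat.cast_pow]
  · have hempty : {v : Fin m → E | LinearIndependent F v} = ∅ :=
      Set.eq_empty_of_forall_notMem fun v hv =>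
        hm.not_ge (by simpa using LinearIndependent.fintype_card_le_finrank hv)
    rw [hempty, Set.ncard_empty, Nat.cast_zero,
      Finset.prod_eq_zero (Finset.mem_range.2 hm) (sub_self _)]

theorem ncard_comp_eq {f : E →ₗ[F] E'} {m : ℕ} {w : Fin m → E'}
    (hw : ∀ i, w i ∈ LinearMap.range f) :
    {v : Fin m → E | f ∘ v = w}.ncard = Fintype.card F ^ (finrank F (LinearMap.ker f) * m) := by
  choose v₀ hv₀ using hw
  have himage : {v : Fin m → E | f ∘ v = w} =
      (fun (c : Fin m → LinearMap.ker f) i => v₀ i + c i) '' Set.univ := by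
    ext v
    constructor
    · rintro rfl
      exact ⟨fun i => ⟨v i - v₀ i, by simp [hv₀]⟩, trivial, by simp⟩
    · rintro ⟨c, -, rfl⟩
      exact funext fun i => by simp [hv₀]
  rw [himage, Set.ncard_image_of_injective _ fun c d h => by simpa [funext_iff] using h,
    Set.ncard_univ, Nat.card_fun, Nat.card_fin,
    Module.natCard_eq_pow_finrank (K := F) (V := LinearMap.ker f), Nat.card_eq_fintype_card,
    pow_mul]

theorem ncard_linearIndependent_comp (f : E →ₗ[F] E') (m : ℕ) :
    ({v : Fin m → E | LinearIndependent F (f ∘ v)}.ncard : R) =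
      (Fintype.card F : R) ^ (finrank F (LinearMap.ker f) * m) * ∏ s ∈ Finset.range m,
        ((Fintype.card F : R) ^ finrank F (LinearMap.range f) - (Fintype.card F : R) ^ s) := by
  have : Finite (LinearMap.range f) := Finite.of_surjective _ f.surjective_rangeRestrict
  have hcomp (v : Fin m → E) :
      LinearIndependent F (f ∘ v) ↔ LinearIndependent F (f.rangeRestrict ∘ v) :=
    LinearMap.linearIndependent_iff (v := f.rangeRestrict ∘ v) _ (LinearMap.range f).ker_subtype
  rw [mul_comm, ← ncard_linearIndependent F (LinearMap.range f) m]
  refine ncard_eq_ncard_mul_of_fiber (f := (f.rangeRestrict ∘ ·)) (Set.toFinite _) (Set.toFinite _)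
    (fun v => (hcomp v).1) fun w hw => ?_
  rw [← Nat.cast_pow, ← f.ker_rangeRestrict,
    ← ncard_comp_eq (f := f.rangeRestrict) (w := w) fun i => by
      simp [LinearMap.range_rangeRestrict]]
  congr 2
  ext v
  exact ⟨fun h => h.2, fun h => ⟨(hcomp v).2 (by rwa [h]), h⟩⟩

theorem ncard_framesMod {A B : Submodule F E} (hBA : B ≤ A) (m : ℕ) :
    ((framesMod A B m).ncard : R) = (Fintype.card F : R) ^ (finrank F B * m) *
      ∏ s ∈ Finset.range m,
        ((Fintype.card F : R) ^ (finrank F A - finrank F B) - (Fintype.card F : R) ^ s) := by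
  have himage : framesMod A B m =
      (A.subtype ∘ ·) '' {v : Fin m → A | LinearIndependent F ((B.mkQ ∘ₗ A.subtype) ∘ v)} := by
    ext v
    constructor
    · rintro ⟨hvA, hv⟩
      exact ⟨fun i => ⟨v i, hvA i⟩, hv, rfl⟩
    · rintro ⟨v, hv, rfl⟩
      exact ⟨fun i => (v i).2, hv⟩
  have hker : finrank F (LinearMap.ker (B.mkQ ∘ₗ A.subtype)) = finrank F B := by
    rw [LinearMap.ker_comp, Submodule.ker_mkQ]
    exact (Submodule.comapSubtypeEquivOfLe hBA).finrank_eq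
  have hrange :
      finrank F (LinearMap.range (B.mkQ ∘ₗ A.subtype)) = finrank F A - finrank F B := by
    rw [← hker]
    exact Nat.eq_sub_of_add_eq (LinearMap.finrank_range_add_finrank_ker _)
  rw [himage, Set.ncard_image_of_injective _ A.injective_subtype.comp_left,
    ncard_linearIndependent_comp, hker, hrange]

theorem ncard_linearIndependent_sup_span_mem {T : Submodule F E} {m : ℕ}
    {P : Set (Submodule F E)} (hP : ∀ V ∈ P, T ≤ V ∧ finrank F V = finrank F T + m) :
    ({v : Fin m → E | LinearIndependent F (T.mkQ ∘ v) ∧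
      T ⊔ Submodule.span F (Set.range v) ∈ P}.ncard : R) =
        P.ncard * ((Fintype.card F : R) ^ (finrank F T * m) *
          ∏ s ∈ Finset.range m, ((Fintype.card F : R) ^ m - (Fintype.card F : R) ^ s)) := by
  refine ncard_eq_ncard_mul_of_fiber (f := fun v => T ⊔ Submodule.span F (Set.range v))
    (Set.toFinite _) (Set.toFinite _) (fun v hv => hv.2) fun V hV => ?_
  obtain ⟨hTV, hdim⟩ := hP V hV
  have hframes := ncard_framesMod (R := R) hTV m
  rw [hdim, Nat.add_sub_cancel_left] at hframes
  rw [← hframes]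
  congr 2
  ext v
  rw [mem_framesMod_iff_sup_span_eq hTV hdim]
  exact ⟨fun h => ⟨h.1.1, h.2⟩, fun h => ⟨⟨h.1, by rwa [h.2]⟩, h.2⟩⟩

end Frames

section Counting

theorem prod_pow_sub_pow_ne_zero {q : ℕ} (hq : 1 < q) (m : ℕ) :
    ∏ s ∈ Finset.range m, ((q : ℚ) ^ m - (q : ℚ) ^ s) ≠ 0 :=
  Finset.prod_ne_zero_iff.2 fun _ hs =>
    (sub_pos.2 (pow_lt_pow_right₀ (by exact_mod_cast hq) (Finset.mem_range.1 hs))).ne'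

theorem prod_pow_sub_pow_eq_gaussBinom_mul {q : ℕ} (hq : 1 < q) (n m : ℕ) :
    ∏ s ∈ Finset.range m, ((q : ℚ) ^ n - (q : ℚ) ^ s) =
      gaussBinom q n m * ∏ s ∈ Finset.range m, ((q : ℚ) ^ m - (q : ℚ) ^ s) :=
  (div_mul_cancel₀ _ (prod_pow_sub_pow_ne_zero hq m)).symm

variable {F E : Type*} [Field F] [AddCommGroup E] [Module F E]

/-- The `d`-dimensional subspaces whose intersections with `S₁` and `S₂` have dimensions `t₁` and
`t₂`; for disjoint `S₁` and `S₂` their number is the paper's `N(k, d, u₁, u₂, t₁, t₂)`. -/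
def subspacesOfProfile (S₁ S₂ : Submodule F E) (d t₁ t₂ : ℕ) : Set (Submodule F E) :=
  {V | finrank F V = d ∧ finrank F ↥(V ⊓ S₁) = t₁ ∧ finrank F ↥(V ⊓ S₂) = t₂}

variable [Fintype F] [Finite E] {S S₁ S₂ T₁ T₂ W : Submodule F E}

theorem ncard_inf_eq (hWS : W ≤ S) (m : ℕ) :
    ({V : Submodule F E | finrank F V = finrank F W + m ∧ V ⊓ S = W}.ncard : ℚ) =
      (Fintype.card F : ℚ) ^ ((finrank F S - finrank F W) * m) *
        gaussBinom (Fintype.card F) (finrank F E - finrank F S) m := by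
  have hq : 1 < Fintype.card F := Fintype.one_lt_card
  have hframes : {v : Fin m → E | LinearIndependent F (W.mkQ ∘ v) ∧
      W ⊔ Submodule.span F (Set.range v) ∈
        {V : Submodule F E | finrank F V = finrank F W + m ∧ V ⊓ S = W}} = framesMod ⊤ S m := by
    ext v
    constructor
    · rintro ⟨hv, -, h⟩
      exact ⟨fun _ => trivial, (linearIndependent_mkQ_comp_iff_sup_span_inf_eq hWS hv).2 h⟩
    · rintro ⟨-, hv⟩
      have hvW := linearIndependent_mkQ_comp_mono hWS hv
      exact ⟨hvW, finrank_sup_span_eq hvW,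
        (linearIndependent_mkQ_comp_iff_sup_span_inf_eq hWS hvW).1 hv⟩
  have hcount := ncard_linearIndependent_sup_span_mem (R := ℚ) (T := W) (m := m)
    (P := {V | finrank F V = finrank F W + m ∧ V ⊓ S = W}) fun V hV => ⟨hV.2 ▸ inf_le_left, hV.1⟩
  obtain ⟨c, hc⟩ := Nat.exists_eq_add_of_le (Submodule.finrank_mono hWS)
  rw [hframes, ncard_framesMod le_top, finrank_top, prod_pow_sub_pow_eq_gaussBinom_mul hq, hc,
    add_mul, pow_add] at hcount
  rw [hc, Nat.add_sub_cancel_left]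
  have hW : (Fintype.card F : ℚ) ^ (finrank F W * m) ≠ 0 := by positivity
  exact mul_right_cancel₀ (mul_ne_zero hW (prod_pow_sub_pow_ne_zero hq m))
    (by linear_combination -hcount)

theorem ncard_le_finrank_eq (S : Submodule F E) (m : ℕ) :
    ({V : Submodule F E | V ≤ S ∧ finrank F V = m}.ncard : ℚ) =
      gaussBinom (Fintype.card F) (finrank F S) m := by
  have himage : {V : Submodule F E | V ≤ S ∧ finrank F V = m} =
      Submodule.map S.subtype '' {V : Submodule F S | finrank F V = m} := by
    ext V
    constructor
    · rintro ⟨hV, rfl⟩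
      exact ⟨V.submoduleOf S, (Submodule.submoduleOfEquivOfLe hV).finrank_eq,
        by simpa [Submodule.submoduleOf] using hV⟩
    · rintro ⟨V, rfl, rfl⟩
      exact ⟨Submodule.map_subtype_le S V, Submodule.finrank_map_subtype_eq S V⟩
  rw [himage, Set.ncard_image_of_injective _
    (Submodule.map_injective_of_injective S.injective_subtype)]
  simpa using ncard_inf_eq (F := F) (E := S) (le_refl ⊥) m

theorem ncard_le_sup_inf_eq (hS : Disjoint S₁ S₂) (h₁ : T₁ ≤ S₁) (h₂ : T₂ ≤ S₂) (t : ℕ) :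
    ({W : Submodule F E | W ≤ S₁ ⊔ S₂ ∧ W ⊓ S₁ = T₁ ∧ W ⊓ S₂ = T₂ ∧
      finrank F W = finrank F T₁ + finrank F T₂ + t}.ncard : ℚ) =
      (∏ s ∈ Finset.range t, ((Fintype.card F : ℚ) ^ t - (Fintype.card F : ℚ) ^ s)) *
        gaussBinom (Fintype.card F) (finrank F S₁ - finrank F T₁) t *
        gaussBinom (Fintype.card F) (finrank F S₂ - finrank F T₂) t := by
  have hq : 1 < Fintype.card F := Fintype.one_lt_card
  have hT := finrank_sup_eq_add_of_disjoint (hS.mono h₁ h₂)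
  have hinj : Set.InjOn (fun p : (Fin t → E) × (Fin t → E) => p.1 + p.2)
      (framesMod S₁ T₁ t ×ˢ framesMod S₂ T₂ t) := by
    rintro ⟨a, b⟩ ⟨ha, hb⟩ ⟨a', b'⟩ ⟨ha', hb'⟩ h
    have heq (i : Fin t) := eq_and_eq_of_add_eq_add_of_disjoint hS (ha.1 i) (hb.1 i) (ha'.1 i)
      (hb'.1 i) (congrFun h i)
    exact Prod.ext (funext fun i => (heq i).1) (funext fun i => (heq i).2)
  have hcount := ncard_linearIndependent_sup_span_mem (R := ℚ) (T := T₁ ⊔ T₂) (m := t)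
    (P := {W | W ≤ S₁ ⊔ S₂ ∧ W ⊓ S₁ = T₁ ∧ W ⊓ S₂ = T₂ ∧
      finrank F W = finrank F T₁ + finrank F T₂ + t}) fun W ⟨_, hW₁, hW₂, hW⟩ =>
        ⟨sup_le (hW₁ ▸ inf_le_left) (hW₂ ▸ inf_le_left), by rw [hW, hT]⟩
  rw [setOf_linearIndependent_sup_span_mem_eq_image_add hS h₁ h₂, hinj.ncard_image, Set.ncard_prod,
    Nat.cast_mul, ncard_framesMod h₁, ncard_framesMod h₂, hT,
    prod_pow_sub_pow_eq_gaussBinom_mul hq (finrank F S₁ - _),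
    prod_pow_sub_pow_eq_gaussBinom_mul hq (finrank F S₂ - _), add_mul, pow_add] at hcount
  have hpow : (Fintype.card F : ℚ) ^ (finrank F T₁ * t) * (Fintype.card F : ℚ) ^ (finrank F T₂ * t)
      ≠ 0 := by positivity
  exact mul_right_cancel₀ (mul_ne_zero hpow (prod_pow_sub_pow_ne_zero hq t))
    (by linear_combination -hcount)

theorem ncard_le_sup_finrank_inf (hS : Disjoint S₁ S₂) (t t₁ t₂ : ℕ) :
    ({W : Submodule F E | W ≤ S₁ ⊔ S₂ ∧ finrank F ↥(W ⊓ S₁) = t₁ ∧ finrank F ↥(W ⊓ S₂) = t₂ ∧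
      finrank F W = t₁ + t₂ + t}.ncard : ℚ) =
      subspaceNt (Fintype.card F) t (finrank F S₁) (finrank F S₂) t₁ t₂ := by
  have hfibers := ncard_eq_ncard_mul_of_fiber (f := fun W => (W ⊓ S₁, W ⊓ S₂))
    (s := {W : Submodule F E | W ≤ S₁ ⊔ S₂ ∧ finrank F ↥(W ⊓ S₁) = t₁ ∧
      finrank F ↥(W ⊓ S₂) = t₂ ∧ finrank F W = t₁ + t₂ + t})
    (t := {T | T ≤ S₁ ∧ finrank F T = t₁} ×ˢ {T | T ≤ S₂ ∧ finrank F T = t₂})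
    (N := (∏ s ∈ Finset.range t, ((Fintype.card F : ℚ) ^ t - (Fintype.card F : ℚ) ^ s)) *
        gaussBinom (Fintype.card F) (finrank F S₁ - t₁) t *
        gaussBinom (Fintype.card F) (finrank F S₂ - t₂) t)
    (Set.toFinite _) (Set.toFinite _) ?_ ?_
  · rw [hfibers, Set.ncard_prod, Nat.cast_mul, ncard_le_finrank_eq, ncard_le_finrank_eq,
      subspaceNt]
    ring
  · rintro W ⟨-, h₁, h₂, -⟩
    exact ⟨⟨inf_le_right, h₁⟩, inf_le_right, h₂⟩
  · rintro ⟨T₁, T₂⟩ ⟨⟨h₁, rfl⟩, h₂, rfl⟩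
    rw [← ncard_le_sup_inf_eq hS h₁ h₂]
    congr 2
    ext W
    simp only [Set.mem_ofPred_eq, Prod.mk.injEq]
    constructor
    · rintro ⟨⟨hW, -, -, hd⟩, rfl, rfl⟩
      exact ⟨hW, rfl, rfl, hd⟩
    · rintro ⟨hW, rfl, rfl, hd⟩
      exact ⟨⟨hW, rfl, rfl, hd⟩, rfl, rfl⟩

theorem ncard_subspacesOfProfile_finrank_inf_sup (hS : Disjoint S₁ S₂) (t t₁ t₂ m : ℕ) :
    ({V ∈ subspacesOfProfile S₁ S₂ (t₁ + t₂ + t + m) t₁ t₂ |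
      finrank F ↥(V ⊓ (S₁ ⊔ S₂)) = t₁ + t₂ + t}.ncard : ℚ) =
    subspaceNt (Fintype.card F) t (finrank F S₁) (finrank F S₂) t₁ t₂ *
      ((Fintype.card F : ℚ) ^ ((finrank F S₁ + finrank F S₂ - (t₁ + t₂ + t)) * m) *
        gaussBinom (Fintype.card F) (finrank F E - (finrank F S₁ + finrank F S₂)) m) := by
  have hinf₁ (V : Submodule F E) : V ⊓ (S₁ ⊔ S₂) ⊓ S₁ = V ⊓ S₁ := by
    rw [inf_assoc, inf_eq_right.2 (le_sup_left : S₁ ≤ S₁ ⊔ S₂)]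
  have hinf₂ (V : Submodule F E) : V ⊓ (S₁ ⊔ S₂) ⊓ S₂ = V ⊓ S₂ := by
    rw [inf_assoc, inf_eq_right.2 (le_sup_right : S₂ ≤ S₁ ⊔ S₂)]
  rw [← ncard_le_sup_finrank_inf hS]
  refine ncard_eq_ncard_mul_of_fiber (f := (· ⊓ (S₁ ⊔ S₂))) (Set.toFinite _) (Set.toFinite _) ?_ ?_
  · rintro V ⟨⟨-, h₁, h₂⟩, h⟩
    exact ⟨inf_le_right, by rw [hinf₁, h₁], by rw [hinf₂, h₂], h⟩
  · rintro W ⟨hW, h₁, h₂, hd⟩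
    rw [← finrank_sup_eq_add_of_disjoint hS, ← hd, ← ncard_inf_eq hW]
    congr 2
    ext V
    constructor
    · rintro ⟨⟨⟨h, -⟩, -⟩, hV⟩
      exact ⟨h, hV⟩
    · rintro ⟨h, hV⟩
      exact ⟨⟨⟨h, by rw [← hinf₁, hV, h₁], by rw [← hinf₂, hV, h₂]⟩, by rw [hV]⟩, hV⟩

theorem ncard_subspacesOfProfile (hS : Disjoint S₁ S₂) (d t₁ t₂ : ℕ) :
    ((subspacesOfProfile S₁ S₂ d t₁ t₂).ncard : ℚ) =
      subspaceN (Fintype.card F) (finrank F E) d (finrank F S₁) (finrank F S₂) t₁ t₂ := by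
  have hbounds {V : Submodule F E} (hV : V ∈ subspacesOfProfile S₁ S₂ d t₁ t₂) :
      t₁ + t₂ ≤ finrank F ↥(V ⊓ (S₁ ⊔ S₂)) ∧
        finrank F ↥(V ⊓ (S₁ ⊔ S₂)) ≤ finrank F S₁ + t₂ ∧
        finrank F ↥(V ⊓ (S₁ ⊔ S₂)) ≤ finrank F S₂ + t₁ := by
    obtain ⟨-, rfl, rfl⟩ := hV
    exact ⟨finrank_inf_add_finrank_inf_le hS V, finrank_inf_sup_le V S₁ S₂,
      sup_comm S₁ S₂ ▸ finrank_inf_sup_le V S₂ S₁⟩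
  rw [ncard_eq_sum_ncard_fiber (f := fun V => finrank F ↥(V ⊓ (S₁ ⊔ S₂)) - (t₁ + t₂))
    (t := Finset.range (min (finrank F S₁ - t₁) (finrank F S₂ - t₂) + 1)) (Set.toFinite _) ?_,
    subspaceN, Nat.cast_sum]
  · refine Finset.sum_congr rfl fun t _ => ?_
    have hfiber : {V ∈ subspacesOfProfile S₁ S₂ d t₁ t₂ |
        finrank F ↥(V ⊓ (S₁ ⊔ S₂)) - (t₁ + t₂) = t} = {V ∈ subspacesOfProfile S₁ S₂ d t₁ t₂ |
          finrank F ↥(V ⊓ (S₁ ⊔ S₂)) = t₁ + t₂ + t} := by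
      ext V
      exact and_congr_right fun hV => by have := hbounds hV; omega
    rw [hfiber]
    split_ifs with htd
    · obtain ⟨m, rfl⟩ := Nat.exists_eq_add_of_le htd
      rw [show t + t₁ + t₂ + m = t₁ + t₂ + t + m by ring,
        ncard_subspacesOfProfile_finrank_inf_sup hS,
        show t₁ + t₂ + t + m - t - t₁ - t₂ = m by omega,
        Nat.sub_sub (finrank F E), Nat.sub_sub (_ - t), Nat.sub_sub _ t, add_comm t]
      ring
    · rw [Nat.cast_eq_zero, Set.ncard_eq_zero, Set.eq_empty_iff_forall_notMem]
      rintro V ⟨⟨rfl, -, -⟩, hV⟩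
      exact htd (by have := Submodule.finrank_mono (inf_le_left : V ⊓ (S₁ ⊔ S₂) ≤ V); omega)
  · intro V hV
    have := hbounds hV
    rw [Finset.coe_range, Set.mem_Iio]
    dsimp only
    omega

end Counting

section Complement

theorem ncard_inter_compl_union_add {F E : Type*} [Field F] [Fintype F] [AddCommGroup E]
    [Module F E] [Finite E] {S₁ S₂ : Submodule F E} (hS : Disjoint S₁ S₂) (V : Submodule F E) :
    ((V : Set E) ∩ {v | v ∉ (S₁ : Set E) ∪ S₂}).ncard + Fintype.card F ^ finrank F ↥(V ⊓ S₁) +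
      Fintype.card F ^ finrank F ↥(V ⊓ S₂) = Fintype.card F ^ finrank F V + 1 := by
  have hinter : (↑(V ⊓ S₁) ∩ ↑(V ⊓ S₂) : Set E) = {0} := by
    rw [← Submodule.coe_inf, (hS.mono inf_le_right inf_le_right).eq_bot, Submodule.bot_coe]
  have hunion := Set.ncard_union_add_ncard_inter (↑(V ⊓ S₁) : Set E) ↑(V ⊓ S₂)
  rw [hinter, Set.ncard_singleton, ncard_submodule, ncard_submodule] at hunion
  have hsdiff := Set.ncard_sdiff_add_ncard_of_subset (s := (↑(V ⊓ S₁) ∪ ↑(V ⊓ S₂) : Set E))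
    (Set.union_subset (inf_le_left : V ⊓ S₁ ≤ V) (inf_le_left : V ⊓ S₂ ≤ V))
  have hset : (V : Set E) ∩ {v | v ∉ (S₁ : Set E) ∪ S₂} =
      (V : Set E) \ (↑(V ⊓ S₁) ∪ ↑(V ⊓ S₂)) := by
    rw [Submodule.coe_inf, Submodule.coe_inf, ← Set.inter_union_distrib_left,
      Set.sdiff_self_inter]
    rfl
  rw [← hset, ncard_submodule] at hsdiff
  omega

theorem le_of_pow_add_pow_eq {q a b c d : ℕ} (hq : 1 < q) (hab : a ≤ b)
    (h : q ^ a + q ^ b = q ^ c + q ^ d) : d ≤ b := by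
  by_contra! hbd
  have hqb : 2 * q ^ b ≤ q ^ (b + 1) := pow_succ' q b ▸ Nat.mul_le_mul_right _ hq
  have hqd : q ^ (b + 1) ≤ q ^ d := Nat.pow_le_pow_right hq.le hbd
  have hqa : q ^ a ≤ q ^ b := Nat.pow_le_pow_right hq.le hab
  have hqc : 0 < q ^ c := by positivity
  omega

theorem pow_add_pow_eq_pow_add_pow_iff {q a b c d : ℕ} (hq : 1 < q) :
    q ^ a + q ^ b = q ^ c + q ^ d ↔ a = c ∧ b = d ∨ a = d ∧ b = c := by
  refine ⟨fun h => ?_, by rintro (⟨rfl, rfl⟩ | ⟨rfl, rfl⟩) <;> ring⟩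
  wlog hab : a ≤ b generalizing a b
  · have := this (by omega) (le_of_not_ge hab)
    omega
  wlog hcd : c ≤ d generalizing c d
  · have := this (by omega) (le_of_not_ge hcd)
    omega
  obtain rfl : b = d := (le_of_pow_add_pow_eq hq hcd h.symm).antisymm
    (le_of_pow_add_pow_eq hq hab h)
  exact .inl ⟨Nat.pow_right_injective hq (Nat.add_right_cancel h), rfl⟩

theorem eq_top_of_compl_subset {R M : Type*} [Ring R] [AddCommGroup M] [Module R M]
    {V W : Submodule R M} (hV : V ≠ ⊤) (hVW : (V : Set M)ᶜ ⊆ W) : W = ⊤ := by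
  obtain ⟨y, hy⟩ : ∃ y, y ∉ V := by simpa [Submodule.eq_top_iff'] using hV
  refine Submodule.eq_top_iff'.2 fun v => ?_
  by_cases hv : v ∈ V
  · exact (W.add_mem_iff_left (hVW hy)).1 (hVW fun h => hy ((V.add_mem_iff_right hv).1 h))
  · exact hVW hv

theorem add_mem_and_notMem_of_compl_union_subset {R M : Type*} [Ring R] [AddCommGroup M]
    [Module R M] {S₁ S₂ V : Submodule R M} (hV : {v : M | v ∉ (S₁ : Set M) ∪ S₂} ⊆ V) {x w : M}
    (hxV : x ∈ V) (hx : x ∉ S₁) (hw : w ∈ S₁) (hwV : w ∉ V) : w + x ∈ S₂ ∧ w + x ∉ V := by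
  have hwxV : w + x ∉ V := fun h => hwV ((V.add_mem_iff_left hxV).1 h)
  have hwx : w + x ∉ S₁ := fun h => hx ((S₁.add_mem_iff_right hw).1 h)
  exact ⟨by_contra fun h => hwxV (hV (not_or.2 ⟨hwx, h⟩)), hwxV⟩

theorem subsingleton_sdiff_of_compl_union_subset {R M : Type*} [Ring R] [AddCommGroup M]
    [Module R M] {S₁ S₂ V : Submodule R M} (hS : Disjoint S₁ S₂)
    (hV : {v : M | v ∉ (S₁ : Set M) ∪ S₂} ⊆ V) {x : M} (hxV : x ∈ V) (hx : x ∉ S₁) :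
    ((S₁ : Set M) \ V).Subsingleton := by
  rintro w ⟨hw, hwV⟩ w' ⟨hw', hwV'⟩
  have hsub := S₂.sub_mem (add_mem_and_notMem_of_compl_union_subset hV hxV hx hw hwV).1
    (add_mem_and_notMem_of_compl_union_subset hV hxV hx hw' hwV').1
  rw [add_sub_add_right_eq_sub] at hsub
  exact sub_eq_zero.1 (Submodule.disjoint_def.1 hS _ (S₁.sub_mem hw hw') hsub)

variable {F E : Type*} [Field F] [AddCommGroup E] [Module F E] {S S₁ S₂ V : Submodule F E}

theorem card_eq_two_and_finrank_eq_one_of_sdiff (hne : ((S : Set E) \ V).Nonempty)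
    (hsub : ((S : Set E) \ V).Subsingleton) : Nat.card F = 2 ∧ finrank F S = 1 := by
  obtain ⟨y, hy, hyV⟩ := hne
  have hy₀ : y ≠ 0 := fun h => hyV (h ▸ V.zero_mem)
  refine ⟨Nat.card_eq_two_iff.2 ⟨0, 1, zero_ne_one, ?_⟩, ?_⟩
  · refine Set.eq_univ_of_forall fun c => or_iff_not_imp_left.2 fun hc => ?_
    have hcy : c • y = y :=
      hsub ⟨S.smul_mem c hy, fun h => hyV ((V.smul_mem_iff hc).1 h)⟩ ⟨hy, hyV⟩
    exact smul_left_injective F hy₀ (hcy.trans (one_smul F y).symm)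
  · refine finrank_eq_one_iff'.2 ⟨⟨y, hy⟩, by simpa using hy₀, fun ⟨w, hw⟩ => ?_⟩
    by_cases hwV : w ∈ V
    · have hwy : w + y = y :=
        hsub ⟨S.add_mem hw hy, fun h => hyV ((V.add_mem_iff_right hwV).1 h)⟩ ⟨hy, hyV⟩
      exact ⟨0, Subtype.ext (by simp [add_eq_right.1 hwy])⟩
    · exact ⟨1, Subtype.ext (by simpa using hsub ⟨hy, hyV⟩ ⟨hw, hwV⟩)⟩

theorem card_eq_two_and_finrank_eq_of_compl_union_subset [Module.Finite F E]
    (hS : Disjoint S₁ S₂) (hne : {v : E | v ∉ (S₁ : Set E) ∪ S₂}.Nonempty) (hV : V ≠ ⊤)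
    (hSV : {v : E | v ∉ (S₁ : Set E) ∪ S₂} ⊆ V) :
    Nat.card F = 2 ∧ finrank F E = 2 ∧ finrank F S₁ = 1 ∧ finrank F S₂ = 1 := by
  obtain ⟨x, hx⟩ := hne
  obtain ⟨hx₁, hx₂⟩ := not_or.1 hx
  have hVS : (V : Set E)ᶜ ⊆ (S₁ : Set E) ∪ S₂ := Set.compl_subset_comm.1 hSV
  have hSV' : {v : E | v ∉ (S₂ : Set E) ∪ S₁} ⊆ V := by rwa [Set.union_comm]
  obtain ⟨y, hy⟩ : ∃ y, y ∉ V := by simpa [Submodule.eq_top_iff'] using hV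
  have hne : ((S₁ : Set E) \ V).Nonempty ∧ ((S₂ : Set E) \ V).Nonempty := by
    rcases hVS hy with h | h
    · exact ⟨⟨y, h, hy⟩, y + x, add_mem_and_notMem_of_compl_union_subset hSV (hSV hx) hx₁ h hy⟩
    · exact ⟨⟨y + x, add_mem_and_notMem_of_compl_union_subset hSV' (hSV hx) hx₂ h hy⟩, y, h, hy⟩
  obtain ⟨hF, h₁⟩ := card_eq_two_and_finrank_eq_one_of_sdiff hne.1
    (subsingleton_sdiff_of_compl_union_subset hS hSV (hSV hx) hx₁)
  obtain ⟨-, h₂⟩ := card_eq_two_and_finrank_eq_one_of_sdiff hne.2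
    (subsingleton_sdiff_of_compl_union_subset hS.symm hSV' (hSV hx) hx₂)
  have htop : S₁ ⊔ S₂ = ⊤ := eq_top_of_compl_subset hV fun v hv =>
    (hVS hv).elim (fun h => Submodule.mem_sup_left h) fun h => Submodule.mem_sup_right h
  have hdim := finrank_sup_eq_add_of_disjoint hS
  rw [htop, finrank_top, h₁, h₂] at hdim
  exact ⟨hF, hdim, h₁, h₂⟩

end Complement

section Code

theorem ker_eq_bot_iff_linearIndependent_comp_basis {ι R M M' : Type*} [Ring R] [AddCommGroup M]
    [Module R M] [AddCommGroup M'] [Module R M'] (b : Module.Basis ι R M) {φ : M →ₗ[R] M'} :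
    LinearMap.ker φ = ⊥ ↔ LinearIndependent R (φ ∘ b) := by
  refine ⟨b.linearIndependent.map' φ, fun h => LinearMap.ker_eq_bot.2 ?_⟩
  have hφ : b.constr ℕ (φ ∘ b) = φ := b.ext fun i => by simp
  exact hφ ▸ b.injective_constr_of_linearIndependent h

theorem hammingNorm_add_ncard_zeros {ι K : Type*} [Fintype ι] [Zero K] [DecidableEq K]
    (c : ι → K) : {m | c m = 0}.ncard + hammingNorm c = Fintype.card ι := by
  rw [hammingNorm, Set.ncard_eq_toFinset_card', Set.toFinset_ofPred,
    Finset.card_filter_add_card_filter_not, Finset.card_univ]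

section Maps

variable {F L E R : Type*} [Field F] [Fintype F] [Field L] [Fintype L] [Algebra F L]
  [AddCommGroup E] [Module F E] [CommRing R]

variable (L) in
theorem ncard_ker_eq_bot [Module.Finite F E] :
    ({φ : E →ₗ[F] L | LinearMap.ker φ = ⊥}.ncard : R) =
      ∏ s ∈ Finset.range (finrank F E), ((Fintype.card L : R) - (Fintype.card F : R) ^ s) := by
  let b := Module.finBasis F E
  have himage : {φ : E →ₗ[F] L | LinearMap.ker φ = ⊥} =
      b.constr F '' {v | LinearIndependent F v} := by
    ext φ
    rw [Set.mem_ofPred_eq, ker_eq_bot_iff_linearIndependent_comp_basis b]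
    constructor
    · exact fun h => ⟨φ ∘ b, h, b.constr_self F φ⟩
    · rintro ⟨v, hv, rfl⟩
      simpa [Function.comp_def] using hv
  rw [himage, Set.ncard_image_of_injective _ (b.constr F).injective, ncard_linearIndependent,
    Module.card_eq_pow_finrank (K := F) (V := L), Nat.cast_pow]

variable (L) in
theorem ncard_ker_eq [Module.Finite F E] (V : Submodule F E) :
    ({φ : E →ₗ[F] L | LinearMap.ker φ = V}.ncard : R) =
      ∏ s ∈ Finset.range (finrank F E - finrank F V),
        ((Fintype.card L : R) - (Fintype.card F : R) ^ s) := by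
  have himage : {φ : E →ₗ[F] L | LinearMap.ker φ = V} =
      (· ∘ₗ V.mkQ) '' {ψ : E ⧸ V →ₗ[F] L | LinearMap.ker ψ = ⊥} := by
    ext φ
    constructor
    · rintro rfl
      exact ⟨(LinearMap.ker φ).liftQ φ le_rfl, Submodule.ker_liftQ_eq_bot' _ φ rfl,
        Submodule.liftQ_mkQ _ _ _⟩
    · rintro ⟨ψ, hψ, rfl⟩
      simp only [Set.mem_ofPred_eq, LinearMap.ker_comp] at hψ ⊢
      rw [hψ, Submodule.comap_bot, Submodule.ker_mkQ]
  rw [himage, Set.ncard_image_of_injective _ fun _ _ =>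
      (LinearMap.cancel_right V.mkQ_surjective).1, ncard_ker_eq_bot,
    ← Submodule.finrank_quotient_add_finrank V, Nat.add_sub_cancel]

end Maps

/-- The vector of the values of a linear map at the columns of `G`. The codewords of the lifted
code are these vectors, and the zeros of such a codeword are the columns in the kernel. -/
def evalColumns {ι κ R M : Type*} [Semiring R] [AddCommMonoid M] [Module R M] (G : Matrix κ ι R)
    (φ : (κ → R) →ₗ[R] M) : ι → M :=
  fun m => φ fun a => G a m

theorem evalColumns_injective {ι κ R M : Type*} [Semiring R] [AddCommMonoid M] [Module R M]
    {G : Matrix κ ι R} (hG : Submodule.span R (Set.range fun m a => G a m) = ⊤) :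
    Function.Injective (evalColumns (M := M) G) :=
  fun _ _ h => LinearMap.ext_on_range hG fun m => congrFun h m

variable {F L : Type*} [Field F] [Field L] [Algebra F L] {k n : ℕ} {G : Matrix (Fin k) (Fin n) F}

theorem mem_liftedCode_iff {c : Fin n → L} :
    c ∈ liftedCode L G ↔ ∃ φ : (Fin k → F) →ₗ[F] L, evalColumns G φ = c := by
  classical
  rw [liftedCode, rowCode, Submodule.mem_span_range_iff_exists_fun]
  constructor
  · rintro ⟨x, rfl⟩
    refine ⟨Fintype.linearCombination F x, funext fun m => ?_⟩
    simp [evalColumns, Fintype.linearCombination_apply, Algebra.smul_def, mul_comm]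
  · rintro ⟨φ, rfl⟩
    refine ⟨fun a => φ fun b => if a = b then 1 else 0, funext fun m => ?_⟩
    rw [evalColumns, LinearMap.pi_apply_eq_sum_univ φ]
    simp [Finset.sum_apply, Algebra.smul_def, mul_comm]

open Classical in
theorem setOf_mem_liftedCode_hammingNorm_eq (i : ℕ) :
    {c ∈ liftedCode L G | hammingNorm c = i} = evalColumns G ''
      {φ : (Fin k → F) →ₗ[F] L |
        {m : Fin n | (fun a => G a m) ∈ LinearMap.ker φ}.ncard + i = n} := by
  have hweight (φ : (Fin k → F) →ₗ[F] L) :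
      {m : Fin n | (fun a => G a m) ∈ LinearMap.ker φ}.ncard + hammingNorm (evalColumns G φ) = n :=
    (hammingNorm_add_ncard_zeros (evalColumns G φ)).trans (Fintype.card_fin n)
  ext c
  constructor
  · rintro ⟨hc, rfl⟩
    obtain ⟨φ, rfl⟩ := mem_liftedCode_iff.1 hc
    exact ⟨φ, hweight φ, rfl⟩
  · rintro ⟨φ, hφ, rfl⟩
    exact ⟨mem_liftedCode_iff.2 ⟨φ, rfl⟩, Nat.add_left_cancel ((hweight φ).trans hφ.symm)⟩

variable [Fintype F] [Fintype L]

open Classical in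
theorem ncard_liftedCode_hammingNorm {i : ℕ} (hi : i ≠ 0)
    (hG : Submodule.span F (Set.range fun m a => G a m) = ⊤) :
    ({c ∈ liftedCode L G | hammingNorm c = i}.ncard : ℤ) =
      ∑ j ∈ Finset.Icc 1 k, (subspaceCount G i j : ℤ) *
        ∏ s ∈ Finset.range j, ((Fintype.card L : ℤ) - (Fintype.card F : ℤ) ^ s) := by
  have hk : finrank F (Fin k → F) = k := Module.finrank_fin_fun F
  have : Finite ((Fin k → F) →ₗ[F] L) := Finite.of_injective _ DFunLike.coe_injective
  rw [setOf_mem_liftedCode_hammingNorm_eq,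
    Set.ncard_image_of_injective _ (evalColumns_injective hG),
    ncard_eq_sum_ncard_fiber (f := fun φ => k - finrank F (LinearMap.ker φ))
      (t := Finset.Icc 1 k) (Set.toFinite _) ?_, Nat.cast_sum]
  · refine Finset.sum_congr rfl fun j hj => ?_
    refine ncard_eq_ncard_mul_of_fiber (f := LinearMap.ker) (Set.toFinite _) (Set.toFinite _) ?_ ?_
    · rintro φ ⟨hφ, rfl⟩
      exact ⟨Nat.add_sub_of_le ((Submodule.finrank_le _).trans_eq hk), hφ⟩
    · rintro V ⟨hV, hVi⟩
      rw [show j = finrank F (Fin k → F) - finrank F V by omega, ← ncard_ker_eq L V]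
      congr 2
      ext φ
      constructor
      · exact fun h => h.2
      · rintro rfl
        exact ⟨⟨hVi, by rw [hk]⟩, rfl⟩
  · intro φ hφ
    have hker : LinearMap.ker φ ≠ ⊤ := fun h => hi (by
      simpa only [Set.mem_ofPred_eq, h, Submodule.mem_top, Set.ofPred_true, Set.ncard_univ,
        Nat.card_fin, Nat.add_eq_left] using hφ)
    have hlt : finrank F (LinearMap.ker φ) < k := (Submodule.finrank_lt hker).trans_eq hk
    rw [Finset.coe_Icc]
    exact ⟨Nat.sub_pos_of_lt hlt, Nat.sub_le _ _⟩

theorem weightEnumerator_liftedCode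
    (hspan : n ≠ 0 → Submodule.span F (Set.range fun m a => G a m) = ⊤) :
    weightEnumerator (liftedCode L G) =
      1 + ∑ i ∈ Finset.Icc 1 n, ∑ j ∈ Finset.Icc 1 k,
        Polynomial.C ((subspaceCount G i j : ℤ) *
          ∏ s ∈ Finset.range j, ((Fintype.card L : ℤ) - (Fintype.card F : ℤ) ^ s)) *
            Polynomial.X ^ i := by
  classical
  have hzero : {c ∈ liftedCode L G | hammingNorm c = 0} = {0} := by
    ext c
    rw [Set.mem_ofPred_eq, hammingNorm_eq_zero, Set.mem_singleton_iff]
    exact and_iff_right_of_imp fun h => h ▸ Submodule.zero_mem _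
  rw [weightEnumerator, Finset.range_eq_Ico, Finset.sum_eq_sum_Ico_succ_bot (Nat.succ_pos n)]
  congr 1
  · rw [pow_zero, mul_one, ← Polynomial.C_1]
    convert congrArg (fun s : Set (Fin n → L) => Polynomial.C (s.ncard : ℤ)) hzero
    simp
  · refine Finset.sum_congr rfl fun i hi => ?_
    obtain ⟨hi₁, hi₂⟩ := Finset.mem_Ico.1 hi
    rw [← Finset.sum_mul, ← map_sum]
    congr 2
    convert ncard_liftedCode_hammingNorm (L := L) (by omega : i ≠ 0) (hspan (by omega))

end Code

section Columns

variable {F : Type*} [Field F] [Fintype F] {k n : ℕ} {S₁ S₂ : Submodule F (Fin k → F)}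
  {G : Matrix (Fin k) (Fin n) F}

theorem ncard_columns_mem_add (hS : Disjoint S₁ S₂)
    (hG : HasColumns G {v | v ∉ (S₁ : Set (Fin k → F)) ∪ S₂}) (V : Submodule F (Fin k → F)) :
    {m : Fin n | (fun a => G a m) ∈ V}.ncard + Fintype.card F ^ finrank F ↥(V ⊓ S₁) +
      Fintype.card F ^ finrank F ↥(V ⊓ S₂) = Fintype.card F ^ finrank F V + 1 := by
  rw [← ncard_inter_compl_union_add hS V, ← hG.image_eq, Set.image_univ,
    ← Set.image_preimage_eq_inter_range, Set.ncard_image_of_injective _ (Set.injOn_univ.1 hG.injOn)]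
  rfl

theorem length_of_hasColumns (hS : Disjoint S₁ S₂)
    (hG : HasColumns G {v | v ∉ (S₁ : Set (Fin k → F)) ∪ S₂}) :
    n + Fintype.card F ^ finrank F S₁ + Fintype.card F ^ finrank F S₂ =
      Fintype.card F ^ k + 1 := by
  have hcount := ncard_columns_mem_add hS hG ⊤
  rw [top_inf_eq, top_inf_eq, finrank_top, Module.finrank_fin_fun] at hcount
  simpa only [Submodule.mem_top, Set.ofPred_true, Set.ncard_univ, Nat.card_fin] using hcount

theorem span_columns_eq_top (hS : Disjoint S₁ S₂)
    (hex : ¬ (Fintype.card F = 2 ∧ k = 2 ∧ finrank F S₁ = 1 ∧ finrank F S₂ = 1))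
    (hG : HasColumns G {v | v ∉ (S₁ : Set (Fin k → F)) ∪ S₂}) (hn : n ≠ 0) :
    Submodule.span F (Set.range fun m a => G a m) = ⊤ := by
  by_contra hspan
  have hrange : (Set.range fun m a => G a m) = {v | v ∉ (S₁ : Set (Fin k → F)) ∪ S₂} := by
    rw [← hG.image_eq, Set.image_univ]
  have hne : {v | v ∉ (S₁ : Set (Fin k → F)) ∪ S₂}.Nonempty :=
    ⟨_, hG.mapsTo (Set.mem_univ ⟨0, Nat.pos_of_ne_zero hn⟩)⟩
  have h := card_eq_two_and_finrank_eq_of_compl_union_subset hS hne hspan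
    (hrange ▸ Submodule.subset_span)
  rw [Nat.card_eq_fintype_card, Module.finrank_fin_fun] at h
  exact hex h

theorem subspaceCount_eq_ncard_union (hS : Disjoint S₁ S₂)
    (hG : HasColumns G {v | v ∉ (S₁ : Set (Fin k → F)) ∪ S₂}) {i j t₁ t₂ : ℕ} (hj : j ≤ k)
    (ht : (n : ℤ) - i = (Fintype.card F : ℤ) ^ (k - j) - (Fintype.card F : ℤ) ^ t₁ -
      (Fintype.card F : ℤ) ^ t₂ + 1) :
    subspaceCount G i j =
      (subspacesOfProfile S₁ S₂ (k - j) t₁ t₂ ∪ subspacesOfProfile S₁ S₂ (k - j) t₂ t₁).ncard := by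
  rw [subspaceCount]
  congr 1
  ext V
  have hcount := ncard_columns_mem_add hS hG V
  have hdim : finrank F V + j = k ↔ finrank F V = k - j := by omega
  simp only [subspacesOfProfile, Set.mem_union, Set.mem_ofPred_eq, hdim, ← and_or_left]
  refine and_congr_right fun hV => ?_
  rw [← pow_add_pow_eq_pow_add_pow_iff (Fintype.one_lt_card (α := F))]
  rw [hV] at hcount
  zify at hcount ⊢
  constructor <;> intro h <;> linarith

theorem subspaceCount_of_ne (hS : Disjoint S₁ S₂)
    (hG : HasColumns G {v | v ∉ (S₁ : Set (Fin k → F)) ∪ S₂}) {i j t₁ t₂ : ℕ} (hj : j ≤ k)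
    (ht : (n : ℤ) - i = (Fintype.card F : ℤ) ^ (k - j) - (Fintype.card F : ℤ) ^ t₁ -
      (Fintype.card F : ℤ) ^ t₂ + 1) (hne : t₁ ≠ t₂) :
    (subspaceCount G i j : ℚ) =
      subspaceN (Fintype.card F) k (k - j) (finrank F S₁) (finrank F S₂) t₁ t₂ +
        subspaceN (Fintype.card F) k (k - j) (finrank F S₁) (finrank F S₂) t₂ t₁ := by
  have hdisj : Disjoint (subspacesOfProfile S₁ S₂ (k - j) t₁ t₂)
      (subspacesOfProfile S₁ S₂ (k - j) t₂ t₁) :=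
    Set.disjoint_left.2 fun V hV hV' => hne (hV.2.1.symm.trans hV'.2.1)
  rw [subspaceCount_eq_ncard_union hS hG hj ht, Set.ncard_union_eq hdisj, Nat.cast_add,
    ncard_subspacesOfProfile hS, ncard_subspacesOfProfile hS, Module.finrank_fin_fun]

theorem subspaceCount_of_eq (hS : Disjoint S₁ S₂)
    (hG : HasColumns G {v | v ∉ (S₁ : Set (Fin k → F)) ∪ S₂}) {i j t : ℕ} (hj : j ≤ k)
    (ht : (n : ℤ) - i = (Fintype.card F : ℤ) ^ (k - j) - (Fintype.card F : ℤ) ^ t -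
      (Fintype.card F : ℤ) ^ t + 1) :
    (subspaceCount G i j : ℚ) =
      subspaceN (Fintype.card F) k (k - j) (finrank F S₁) (finrank F S₂) t t := by
  rw [subspaceCount_eq_ncard_union hS hG hj ht, Set.union_self, ncard_subspacesOfProfile hS,
    Module.finrank_fin_fun]

theorem exists_isDimPair_of_subspaceCount_ne_zero (hS : Disjoint S₁ S₂)
    (hG : HasColumns G {v | v ∉ (S₁ : Set (Fin k → F)) ∪ S₂}) {i j : ℕ}
    (h : subspaceCount G i j ≠ 0) :
    ∃ t₁ t₂, IsDimPair (Fintype.card F) k n (finrank F S₁) (finrank F S₂) i j t₁ t₂ := by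
  obtain ⟨V, hV, hi⟩ := Set.nonempty_of_ncard_ne_zero h
  have hcount := ncard_columns_mem_add hS hG V
  have hbounds (S : Submodule F (Fin k → F)) :
      finrank F S ≤ finrank F ↥(V ⊓ S) + j ∧ finrank F ↥(V ⊓ S) ≤ finrank F S := by
    have hsup := Submodule.finrank_sup_add_finrank_inf_eq V S
    have htop := Submodule.finrank_le (V ⊔ S)
    rw [Module.finrank_fin_fun] at htop
    exact ⟨by omega, Submodule.finrank_mono inf_le_right⟩
  refine ⟨_, _, hbounds S₁, hbounds S₂, ?_⟩
  rw [Nat.sub_eq_of_eq_add hV.symm]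
  zify at hcount hi
  linarith

end Columns

theorem mainTheorem3 {F L : Type*} [Field F] [Fintype F] [Field L] [Fintype L] [Algebra F L]
    (q ℓ k n u₁ u₂ : ℕ) (hq : Fintype.card F = q) (hL : Fintype.card L = q ^ ℓ)
    (S₁ S₂ : Submodule F (Fin k → F))
    (hu₁ : Module.finrank F S₁ = u₁) (hu₂ : Module.finrank F S₂ = u₂)
    (hS : Module.finrank F (S₁ ⊓ S₂ : Submodule F (Fin k → F)) = 0)
    -- the only case with `u₁, u₂ < k` in which the columns do not span `F ^ k`
    (hex : ¬ (q = 2 ∧ k = 2 ∧ u₁ = 1 ∧ u₂ = 1))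
    (G : Matrix (Fin k) (Fin n) F)
    (hG : HasColumns G {v | v ∉ (S₁ : Set (Fin k → F)) ∪ (S₂ : Set (Fin k → F))}) :
    -- the length
    (n : ℤ) = (q : ℤ) ^ k - (q : ℤ) ^ u₁ - (q : ℤ) ^ u₂ + 1 ∧
    -- the weight enumerator of the lifted code
    weightEnumerator (liftedCode L G) =
      1 + ∑ i ∈ Finset.Icc 1 n, ∑ j ∈ Finset.Icc 1 k,
        Polynomial.C ((subspaceCount G i j : ℤ) *
          ∏ s ∈ Finset.range j, ((q : ℤ) ^ ℓ - (q : ℤ) ^ s)) * Polynomial.X ^ i ∧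
    -- the values of its coefficients
    (∀ i ∈ Finset.Icc 1 n, ∀ j ∈ Finset.Icc 1 k,
      (∀ t₁ t₂ : ℕ, IsDimPair q k n u₁ u₂ i j t₁ t₂ → t₁ ≠ t₂ →
        (subspaceCount G i j : ℚ) =
          subspaceN q k (k - j) u₁ u₂ t₁ t₂ + subspaceN q k (k - j) u₁ u₂ t₂ t₁) ∧
      (∀ t₁ t₂ : ℕ, IsDimPair q k n u₁ u₂ i j t₁ t₂ → t₁ = t₂ →
        (subspaceCount G i j : ℚ) = subspaceN q k (k - j) u₁ u₂ t₁ t₂) ∧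
      ((¬ ∃ t₁ t₂ : ℕ, IsDimPair q k n u₁ u₂ i j t₁ t₂) → subspaceCount G i j = 0)) ∧
    -- the meaning of the numbers `N(k, d, u₁, u₂, t₁, t₂)`
    (∀ d t₁ t₂ : ℕ,
      ({V : Submodule F (Fin k → F) | Module.finrank F V = d ∧
        Module.finrank F (V ⊓ S₁ : Submodule F (Fin k → F)) = t₁ ∧
        Module.finrank F (V ⊓ S₂ : Submodule F (Fin k → F)) = t₂}.ncard : ℚ) =
          subspaceN q k d u₁ u₂ t₁ t₂) := by
  subst hq hu₁ hu₂
  rw [Submodule.finrank_eq_zero, ← disjoint_iff] at hS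
  refine ⟨?_, ?_, fun i _ j hj => ⟨fun t₁ t₂ ht hne => ?_, ?_, fun h => ?_⟩, fun d t₁ t₂ => ?_⟩
  · have hn := length_of_hasColumns hS hG
    zify at hn
    linarith
  · rw [weightEnumerator_liftedCode (span_columns_eq_top hS hex hG), hL, Nat.cast_pow]
  · exact subspaceCount_of_ne hS hG (Finset.mem_Icc.1 hj).2 ht.2.2 hne
  · rintro t _ ht rfl
    exact subspaceCount_of_eq hS hG (Finset.mem_Icc.1 hj).2 ht.2.2
  · by_contra hcount
    exact h (exists_isDimPair_of_subspaceCount_ne_zero hS hG hcount)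
  · have hN := ncard_subspacesOfProfile hS d t₁ t₂
    rwa [Module.finrank_fin_fun] at hN
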